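/- A hypergraph $G=(V(G),E(G),f_G)$ consists of a finite set $V(G)$ of vertices, a finite set $E(G)$ of edges and a function $f_G\colon E(G)\to 2^{V(G)}\setminus\{\emptyset\}$; parallel edges are allowed, i.e. $f_G$ need not be injective. The incidence graph of $G$ is the bipartite graph with vertex set $V(G)\,\dot\cup\,E(G)$ in which $v\in V(G)$ and $e\in E(G)$ are adjacent if and only if $v\in f_G(e)$. A hypergraph is connected, respectively Berge-acyclic, if its incidence graph is connected, respectively acyclic. An incidence homomorphism from a hypergraph $F$ to a hypergraph $G$ is a pair of maps $h_V\colon V(F)\to V(G)$, $h_E\colon E(F)\to E(G)$ such that $h_V(f_F(e))\subseteq f_G(h_E(e))$ for every $e\in E(F)$; $\mathsf{InHom}(F,G)$ denotes the number of incidence homomorphisms from $F$ to $G$. Color refinement on a hypergraph $G$ sets $C^G_0(v):=1$ and, for $i\ge 0$, $$C^G_{i+1}(v):=\{\!\!\{\,\{\!\!\{\,C^G_i(u) : u\in f_G(e)\,\}\!\!\} : e\in E(G),\ v\in f_G(e)\,\}\!\!\}$$ for every $v\in V(G)$, where $\{\!\!\{\cdot\}\!\!\}$ denotes a multiset. It distinguishes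 two hypergraphs $G$ and $H$ if there is an $i\ge 0$ with $\{\!\!\{C^G_i(v) : v\in V(G)\}\!\!\}\ne\{\!\!\{C^H_i(v) : v\in V(H)\}\!\!\}$. **Lemma.** For all hypergraphs $G$ and $H$, the following are equivalent: 1. $\mathsf{InHom}(B,G)=\mathsf{InHom}(B,H)$ for every connected Berge-acyclic hypergraph $B$. 2. Color refinement does not distinguish $G$ and $H$. -/

import Mathlib

/-- A hypergraph, possibly with parallel edges, with vertex set `V` and edge set `E`: every edge is
assigned a nonempty finite set of vertices. Two edges may be assigned the same set. -/
structure MultiHypergraph (V E : Type*) where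
  /-- the incidence function -/
  inc : E → Finset V
  inc_nonempty : ∀ e, (inc e).Nonempty

namespace MultiHypergraph

/-- The incidence graph: the bipartite graph on `V ⊕ E` in which `v` and `e` are adjacent iff the
vertex `v` lies on the edge `e`. -/
def incidenceGraph {V E : Type*} (G : MultiHypergraph V E) : SimpleGraph (V ⊕ E) where
  Adj x y :=
    (∃ v e, v ∈ G.inc e ∧ x = Sum.inl v ∧ y = Sum.inr e) ∨
    (∃ v e, v ∈ G.inc e ∧ x = Sum.inr e ∧ y = Sum.inl v)
  symm := ⟨by
    rintro x y (⟨v, e, h, hx, hy⟩ | ⟨v, e, h, hx, hy⟩)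
    · exact Or.inr ⟨v, e, h, hy, hx⟩
    · exact Or.inl ⟨v, e, h, hy, hx⟩⟩
  loopless := ⟨by
    rintro x (⟨v, e, -, hx, hy⟩ | ⟨v, e, -, hx, hy⟩) <;> simp [hx] at hy⟩

/-- A hypergraph is connected if its incidence graph is connected. -/
def IsConnected {V E : Type*} (G : MultiHypergraph V E) : Prop :=
  G.incidenceGraph.Connected

/-- A hypergraph is Berge-acyclic if its incidence graph is acyclic. -/
def IsBergeAcyclic {V E : Type*} (G : MultiHypergraph V E) : Prop :=
  G.incidenceGraph.IsAcyclic

/-- A pair `(h_V, h_E)` of maps is an incidence homomorphism from `F` to `G` if the image under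
`h_V` of every edge `e` of `F` is contained in the edge `h_E e` of `G`. -/
def IsIncidenceHom {V E V' E' : Type*} (F : MultiHypergraph V E) (G : MultiHypergraph V' E')
    (h : (V → V') × (E → E')) : Prop :=
  ∀ e : E, ∀ v ∈ F.inc e, h.1 v ∈ G.inc (h.2 e)

/-- The number of incidence homomorphisms from `F` to `G`. -/
noncomputable def inHom {V E V' E' : Type*} (F : MultiHypergraph V E)
    (G : MultiHypergraph V' E') : ℕ :=
  Nat.card {h : (V → V') × (E → E') // F.IsIncidenceHom G h}

/-- The colors used in round `i` of color refinement: a single color in round `0`, and multisets of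
multisets of colors of round `i` in round `i + 1`. -/
def RefColor : ℕ → Type
  | 0 => Unit
  | i + 1 => Multiset (Multiset (RefColor i))

open Classical in
/-- The color that color refinement assigns to a vertex in round `i`: in round `i + 1`, the vertex
`v` gets the multiset of the induced colors of the edges `e` on which it lies, where the induced
color of `e` is the multiset of the round `i` colors of the vertices of `e`. -/
noncomputable def refColor {V E : Type*} [Fintype E] (G : MultiHypergraph V E) :
    (i : ℕ) → V → RefColor i
  | 0, _ => ()
  | i + 1, v =>
    (Finset.univ.filter fun e : E => v ∈ G.inc e).val.map
      fun e => (G.inc e).val.map (G.refColor i)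

/-- Color refinement distinguishes `G` and `H` if, in some round, the multisets of the colors of
all vertices of `G` and of all vertices of `H` differ. -/
def ColorRefinementDistinguishes {V E V' E' : Type*} [Fintype V] [Fintype E] [Fintype V']
    [Fintype E'] (G : MultiHypergraph V E) (H : MultiHypergraph V' E') : Prop :=
  ∃ i : ℕ, (Finset.univ : Finset V).val.map (G.refColor i) ≠
    (Finset.univ : Finset V').val.map (H.refColor i)

end MultiHypergraph

/-! Incidence homomorphisms from a connected `B` are graph homomorphisms of incidence graphs that
send one chosen vertex of `B` to the vertex side. So both conditions concern counts of rooted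
homomorphisms from finite trees, encoded by `GraftTree`. From counts to colors: gluing at the root
multiplies counts, so each vertex of a graph is a character of the monoid of rooted trees. Distinct
characters are linearly independent, hence equal sums over two multisets force equal multisets
(`Multiset.rel_of_sum_map_eq`). Used once globally, this matches the vertices of `G` and `H` by
character; used at neighborhoods, it shows by induction that equal characters give equal colors.
From colors to counts: by induction on the tree, a sufficiently late color determines the rooted
count. Repeated leaf removal shows that `GraftTree` covers all finite rooted trees. -/

open Finset

/-! ### The monoid of rooted trees and its homomorphism counts. -/

/-- Rooted trees, built from a single vertex by grafting: `graft s t` arises from `s` and `t` by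
joining their roots by an edge, and keeps the root of `s`. -/
inductive GraftTree : Type
  | leaf : GraftTree
  | graft (s t : GraftTree) : GraftTree

namespace GraftTree

/-- The rooted tree obtained by identifying the roots of two rooted trees. -/
def glue (s : GraftTree) : GraftTree → GraftTree
  | leaf => s
  | graft t u => graft (glue s t) u

instance : Monoid GraftTree where
  mul := glue
  one := leaf
  mul_one _ := rfl
  one_mul t := by
    change glue leaf t = t
    induction t with
    | leaf => rfl
    | graft t u iht _ => simp [glue, iht]
  mul_assoc a b c := by
    change glue (glue a b) c = glue a (glue b c)
    induction c with
    | leaf => rfl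
    | graft t u iht _ => simp [glue, iht]

variable {Y : Type*} [Fintype Y]

open Classical in
/-- The number of homomorphisms from a rooted tree to the graph `A` that send the root to a given
vertex. -/
noncomputable def homCount (A : SimpleGraph Y) : GraftTree → Y → ℕ
  | leaf, _ => 1
  | graft s t, y => homCount A s y * ∑ z with A.Adj y z, homCount A t z

theorem homCount_mul (A : SimpleGraph Y) (s t : GraftTree) (y : Y) :
    homCount A (s * t) y = homCount A s y * homCount A t y := by
  change homCount A (glue s t) y = _
  induction t with
  | leaf => simp [glue, homCount]
  | graft t u iht _ => simp [glue, homCount, iht, mul_assoc]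

/-- The vertex `y` of `A` as a character of the monoid of rooted trees. -/
noncomputable def homCountHom (A : SimpleGraph Y) (y : Y) : GraftTree →* ℕ where
  toFun t := homCount A t y
  map_one' := rfl
  map_mul' s t := homCount_mul A s t y

end GraftTree

/-! ### Recovering multisets of characters from their sums. -/

/-- The differences of multiplicities are the coefficients of a vanishing linear combination of
distinct characters, so Dedekind independence makes them zero. -/
theorem Multiset.eq_of_sum_map_monoidHom_eq {M : Type*} [Monoid M] {s t : Multiset (M →* ℤ)}
    (h : ∀ m, (s.map (· m)).sum = (t.map (· m)).sum) : s = t := by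
  classical
  have hli := linearIndependent_iff'.1 (linearIndependent_monoidHom M ℤ) (s.toFinset ∪ t.toFinset)
    (fun χ => (s.count χ : ℤ) - t.count χ) (by
      funext m
      have key : ∀ u : Multiset (M →* ℤ), u.toFinset ⊆ s.toFinset ∪ t.toFinset →
          (u.map (· m)).sum = ∑ χ ∈ s.toFinset ∪ t.toFinset, (u.count χ : ℤ) * χ m := by
        intro u hu
        rw [Finset.sum_multiset_map_count]
        simp only [nsmul_eq_mul]
        refine Finset.sum_subset hu fun χ _ hχ => ?_
        rw [Multiset.count_eq_zero.2 (fun h => hχ (Multiset.mem_toFinset.2 h)), Nat.cast_zero,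
          zero_mul]
      have := h m
      rw [key s subset_union_left, key t subset_union_right] at this
      simp [sub_mul, Finset.sum_sub_distrib, this])
  ext χ
  by_cases hχ : χ ∈ s.toFinset ∪ t.toFinset
  · have := hli χ hχ
    omega
  · simp only [Finset.mem_union, Multiset.mem_toFinset, not_or] at hχ
    rw [Multiset.count_eq_zero.2 hχ.1, Multiset.count_eq_zero.2 hχ.2]

/-- Counts are cast to `ℤ`, where independence of characters is available. Stated as a matching, so
that other functions can then be compared along it. -/
theorem Multiset.rel_of_sum_map_eq {M α β : Type*} [Monoid M] {f : α → M →* ℕ} {g : β → M →* ℕ}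
    {s : Multiset α} {t : Multiset β}
    (h : ∀ m, (s.map (f · m)).sum = (t.map (g · m)).sum) :
    Multiset.Rel (fun a b => f a = g b) s t := by
  let c : ℕ →* ℤ := (Nat.castRingHom ℤ : ℕ →* ℤ)
  have hc : ∀ φ ψ : M →* ℕ, c.comp φ = c.comp ψ → φ = ψ := fun φ ψ h => by
    ext m
    exact Nat.cast_injective (R := ℤ) (DFunLike.congr_fun h m)
  have key : s.map (fun a => c.comp (f a)) = t.map fun b => c.comp (g b) := by
    refine eq_of_sum_map_monoidHom_eq fun m => ?_
    have := congrArg (Nat.castRingHom ℤ) (h m)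
    rw [map_multiset_sum, map_multiset_sum, Multiset.map_map, Multiset.map_map] at this
    rw [Multiset.map_map, Multiset.map_map]
    exact this
  rw [← Multiset.rel_eq, Multiset.rel_map] at key
  exact key.mono fun a _ b _ h => hc _ _ h

theorem Multiset.Rel.map_eq_map {α β γ : Type*} {r : α → β → Prop} {s : Multiset α}
    {t : Multiset β} (h : Multiset.Rel r s t) {f : α → γ} {g : β → γ}
    (hfg : ∀ a b, r a b → f a = g b) : s.map f = t.map g := by
  rw [← Multiset.rel_eq, Multiset.rel_map]
  exact h.mono fun a _ b _ => hfg a b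

theorem Multiset.rel_of_map_eq_map {α β γ : Type*} {s : Multiset α}
    {t : Multiset β} {f : α → γ} {g : β → γ} (h : s.map f = t.map g) :
    Multiset.Rel (fun a b => f a = g b) s t := by
  rwa [← Multiset.rel_eq, Multiset.rel_map] at h

/-! ### Realizing graft terms as trees. -/

namespace SimpleGraph

/-- The number of homomorphisms from `T` to `A` that send `r` to `y`. -/
noncomputable def rootedHomCount {X Y : Type*} (T : SimpleGraph X) (r : X) (A : SimpleGraph Y)
    (y : Y) : ℕ :=
  Nat.card {h : T →g A // h r = y}

theorem Iso.rootedHomCount_eq {X X' Y : Type*} {T : SimpleGraph X} {T' : SimpleGraph X'}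
    (e : T ≃g T') (r : X) (A : SimpleGraph Y) (y : Y) :
    rootedHomCount T r A y = rootedHomCount T' (e r) A y :=
  Nat.card_congr
    { toFun h := ⟨h.1.comp e.symm.toHom, by simpa using h.2⟩
      invFun h := ⟨h.1.comp e.toHom, by simpa using h.2⟩
      left_inv h := by ext; simp
      right_inv h := by ext; simp }

theorem rootedHomCount_bot_unit {Y : Type*} (A : SimpleGraph Y) (y : Y) :
    rootedHomCount (⊥ : SimpleGraph Unit) () A y = 1 := by
  refine Nat.card_eq_one_iff_unique.2
    ⟨⟨fun a b => ?_⟩, ⟨⟨⟨fun _ => y, fun h => h.elim⟩, rfl⟩⟩⟩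
  ext
  exact a.2.trans b.2.symm

theorem IsTree.sum_sup_edge {X X' : Type*} [Finite X] [Finite X'] {S : SimpleGraph X}
    {T : SimpleGraph X'} (hS : S.IsTree) (hT : T.IsTree) (r : X) (q : X') :
    ((S ⊕g T) ⊔ edge (Sum.inl r) (Sum.inr q)).IsTree := by
  classical
  have := Fintype.ofFinite X
  have := Fintype.ofFinite X'
  refine isTree_iff_connected_and_card.2 ⟨hS.1.sum_sup_edge hT.1, ?_⟩
  have h1 := (isTree_iff_connected_and_card.1 hS).2
  have h2 := (isTree_iff_connected_and_card.1 hT).2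
  have h3 := card_edgeFinset_sup_edge (S ⊕g T) (s := Sum.inl r) (t := Sum.inr q) (by simp) (by simp)
  have h4 := Nat.card_congr (edgeSetSumEquiv (G := S) (H := T))
  rw [Nat.card_sum] at h4
  simp only [edgeFinset_card, ← Nat.card_eq_fintype_card] at h3
  rw [h3, h4, Nat.card_sum]
  omega

theorem rootedHomCount_sum_sup_edge {X X' Y : Type*} [Finite X] [Finite X'] [Fintype Y]
    (S : SimpleGraph X) (T : SimpleGraph X') (r : X) (q : X') (A : SimpleGraph Y) (y : Y)
    [DecidablePred (A.Adj y)] :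
    rootedHomCount ((S ⊕g T) ⊔ edge (Sum.inl r) (Sum.inr q)) (Sum.inl r) A y =
      rootedHomCount S r A y * ∑ z with A.Adj y z, rootedHomCount T q A z := by
  have e : {h : ((S ⊕g T) ⊔ edge (Sum.inl r) (Sum.inr q)) →g A // h (Sum.inl r) = y} ≃
      {h : S →g A // h r = y} × (Σ z : {z // A.Adj y z}, {h : T →g A // h q = z}) :=
    { toFun h :=
        ⟨⟨⟨fun x => h.1 (Sum.inl x), fun {a b} hab => h.1.map_rel (Or.inl (by simpa using hab))⟩,
          h.2⟩,
          ⟨h.1 (Sum.inr q), by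
            have : A.Adj (h.1 (Sum.inl r)) (h.1 (Sum.inr q)) :=
              h.1.map_rel (Or.inr (by simp [edge_adj]))
            rwa [h.2] at this⟩,
          ⟨⟨fun x => h.1 (Sum.inr x), fun {a b} hab => h.1.map_rel (Or.inl (by simpa using hab))⟩,
            rfl⟩⟩
      invFun p :=
        ⟨⟨Sum.elim p.1.1 p.2.2.1, by
          rintro (a | a) (b | b) hab
          · simp [edge_adj] at hab
            exact p.1.1.map_rel hab
          · simp [edge_adj] at hab
            have := p.2.1.2
            simpa [hab, p.1.2, p.2.2.2] using this
          · simp [edge_adj] at hab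
            have := p.2.1.2
            simpa [hab, p.1.2, p.2.2.2] using this.symm
          · simp [edge_adj] at hab
            exact p.2.2.1.map_rel hab⟩, p.1.2⟩
      left_inv h := by
        ext x
        rcases x with x | x <;> rfl
      right_inv := by
        rintro ⟨⟨h, rfl⟩, ⟨⟨z, hz⟩, ⟨k, hk⟩⟩⟩
        change k q = z at hk
        subst hk
        rfl }
  rw [rootedHomCount, Nat.card_congr e, Nat.card_prod, Nat.card_sigma]
  congr 1
  exact (Finset.sum_subtype (univ.filter (A.Adj y)) (by simp)
    (fun z => rootedHomCount T q A z)).symm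

end SimpleGraph

namespace GraftTree
open SimpleGraph

theorem exists_isTree_rootedHomCount_eq {Y Y' : Type*} [Fintype Y] [Fintype Y'] (A : SimpleGraph Y)
    (A' : SimpleGraph Y') (t : GraftTree) :
    ∃ (X : Type) (_ : Finite X) (T : SimpleGraph X) (r : X), T.IsTree ∧
      (∀ y, rootedHomCount T r A y = homCount A t y) ∧
      ∀ y, rootedHomCount T r A' y = homCount A' t y := by
  induction t with
  | leaf =>
    exact ⟨Unit, inferInstance, ⊥, (), IsTree.of_subsingleton, fun y => rootedHomCount_bot_unit A y, fun y => rootedHomCount_bot_unit A' y⟩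
  | graft s t ihs iht =>
    obtain ⟨X, _, S, r, hS, h1, h2⟩ := ihs
    obtain ⟨X', _, T, q, hT, h3, h4⟩ := iht
    refine ⟨X ⊕ X', inferInstance, _, Sum.inl r, hS.sum_sup_edge hT r q, fun y => ?_, fun y => ?_⟩
    · classical
      simp_rw [rootedHomCount_sum_sup_edge, homCount, h1, h3]
    · classical
      simp_rw [rootedHomCount_sum_sup_edge, homCount, h2, h4]

end GraftTree

/-! ### Every finite rooted tree is a graft term, by leaf removal. -/

namespace SimpleGraph

/-- A homomorphism from `T` consists of a homomorphism from `T` without the leaf `x` and of an image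
for `x`. -/
def homEquivOfLeaf {X Y : Type*} (T : SimpleGraph X) [DecidableEq X] {x r z : X} (hr : r ≠ x)
    (hz : z ≠ x) (hx : ∀ u, T.Adj x u ↔ u = z) (A : SimpleGraph Y) (y : Y) :
    {h : T →g A // h r = y} ≃
      Σ h : {h : T.induce {x}ᶜ →g A // h ⟨r, hr⟩ = y}, {w // A.Adj (h.1 ⟨z, hz⟩) w} where
  toFun h := ⟨⟨h.1.comp (Embedding.induce _).toHom, h.2⟩, h.1 x,
    h.1.map_rel ((hx z).2 rfl).symm⟩
  invFun p := ⟨⟨fun u => if hu : u = x then p.2.1 else p.1.1 ⟨u, hu⟩, by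
    intro a b hab
    by_cases ha : a = x
    · subst ha
      obtain rfl := (hx b).1 hab
      simpa [hz] using p.2.2.symm
    · by_cases hb : b = x
      · subst hb
        obtain rfl := (hx a).1 hab.symm
        simpa [hz] using p.2.2
      · simp only [ha, hb, dite_false]
        exact p.1.1.map_rel (by simpa using hab)⟩, by simpa [hr] using p.1.2⟩
  left_inv h := by
    ext u
    by_cases hu : u = x
    · simp [hu]
    · simp [hu]
  right_inv := by
    rintro ⟨⟨h, rfl⟩, ⟨w, hw⟩⟩
    -- The type of the second component depends on the first; `key` reduces equality of pairs to
    -- equality of the underlying values.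
    have key : ∀ (p q : Σ h' : {h' : T.induce {x}ᶜ →g A // h' ⟨r, hr⟩ = h ⟨r, hr⟩},
        {w // A.Adj (h'.1 ⟨z, hz⟩) w}), p.1 = q.1 → p.2.1 = q.2.1 → p = q := by
      rintro ⟨p, _⟩ ⟨q, _⟩ rfl h2
      simpa [Subtype.ext_iff] using h2
    apply key
    · ext ⟨u, hu⟩
      have : u ≠ x := hu
      simp [this]
    · simp

end SimpleGraph

namespace GraftTree
open SimpleGraph

theorem prod_homCount_of_subsingleton {X Y : Type*} [Fintype X] [Subsingleton X] [Fintype Y]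
    (T : SimpleGraph X) (r : X) (A : SimpleGraph Y) (y : Y) (τ : X → GraftTree)
    [Fintype {h : T →g A // h r = y}] :
    ∑ h : {h : T →g A // h r = y}, ∏ u, homCount A (τ u) (h.1 u) = homCount A (τ r) y := by
  have : Subsingleton {h : T →g A // h r = y} := ⟨fun a b => by
    ext u
    rw [Subsingleton.elim u r, a.2, b.2]⟩
  let h₀ : {h : T →g A // h r = y} :=
    ⟨⟨fun _ => y, fun {a b} h => (h.ne (Subsingleton.elim a b)).elim⟩, rfl⟩
  rw [Fintype.sum_subsingleton _ h₀, Fintype.prod_subsingleton _ r]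
  rfl

/-- Summing over the image of the leaf `x` turns its weight into a neighbor sum at the image of `z`,
which is the factor gained by grafting `τ x` onto `τ z`. -/
theorem prod_homCount_leaf {X Y : Type*} [Fintype X] [Fintype Y] (T : SimpleGraph X)
    [DecidableEq X] {x r z : X} (hr : r ≠ x) (hz : z ≠ x) (hx : ∀ u, T.Adj x u ↔ u = z)
    (A : SimpleGraph Y) (y : Y) (τ : X → GraftTree)
    [Fintype {h : T →g A // h r = y}]
    [Fintype {h : T.induce {x}ᶜ →g A // h ⟨r, hr⟩ = y}] :
    ∑ h : {h : T →g A // h r = y}, ∏ u, homCount A (τ u) (h.1 u) =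
      ∑ h : {h : T.induce {x}ᶜ →g A // h ⟨r, hr⟩ = y},
        ∏ u : ({x}ᶜ : Set X), homCount A (if u = ⟨z, hz⟩ then graft (τ z) (τ x) else τ u) (h.1 u) := by
  classical
  rw [← (homEquivOfLeaf T hr hz hx A y).symm.sum_comp, Fintype.sum_sigma]
  refine Finset.sum_congr rfl fun h _ => ?_
  have h1 : ∀ u : ({x}ᶜ : Set X),
      homCount A (if u = ⟨z, hz⟩ then graft (τ z) (τ x) else τ u) (h.1 u) =
        homCount A (τ u) (h.1 u) *
          if u = ⟨z, hz⟩ then ∑ w with A.Adj (h.1 ⟨z, hz⟩) w, homCount A (τ x) w else 1 := by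
    intro u
    split_ifs with hu
    · subst hu
      simp [homCount]
    · simp
  simp_rw [h1]
  rw [Finset.prod_mul_distrib, Finset.prod_ite_eq' univ, if_pos (mem_univ _),
    Finset.sum_subtype (p := fun w => A.Adj (h.1 ⟨z, hz⟩) w) _ (by simp), Finset.mul_sum]
  refine Finset.sum_congr rfl fun w _ => ?_
  rw [← Finset.mul_prod_erase univ _ (mem_univ x), mul_comm]
  congr 1
  · rw [Finset.prod_subtype (p := fun u => u ∈ ({x}ᶜ : Set X)) _ (by simp)]
    refine Finset.prod_congr rfl fun u _ => ?_
    have : (u : X) ≠ x := u.2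
    simp [homEquivOfLeaf, this]
  · simp [homEquivOfLeaf]

/-- The weights `τ` record the branches already pruned and make the induction on the number of
vertices close. The choice of leaves depends only on `T`, so one term serves both `A` and `A'`. -/
theorem exists_prod_homCount_eq {Y Y' : Type*} [Fintype Y] [Fintype Y'] (A : SimpleGraph Y)
    (A' : SimpleGraph Y') (n : ℕ) : ∀ {X : Type*} [Fintype X] (T : SimpleGraph X) (r : X)
    [∀ y, Fintype {h : T →g A // h r = y}] [∀ y, Fintype {h : T →g A' // h r = y}]
    (τ : X → GraftTree), Fintype.card X = n → T.IsTree → ∃ t : GraftTree,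
      (∀ y, ∑ h : {h : T →g A // h r = y}, ∏ u, homCount A (τ u) (h.1 u) = homCount A t y) ∧
      ∀ y, ∑ h : {h : T →g A' // h r = y}, ∏ u, homCount A' (τ u) (h.1 u) = homCount A' t y := by
  classical
  induction n with
  | zero =>
    intro X _ T r _ _ τ hn
    exact ((Fintype.card_eq_zero_iff.1 hn).false r).elim
  | succ n ih =>
    intro X _ T r _ _ τ hn hT
    rcases subsingleton_or_nontrivial X with hX | hX
    · exact ⟨τ r, fun y => prod_homCount_of_subsingleton T r A y τ,
        fun y => prod_homCount_of_subsingleton T r A' y τ⟩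
    -- A nontrivial tree has two leaves, so one differs from the root.
    · obtain ⟨x, hxr, hdeg⟩ : ∃ x, x ≠ r ∧ T.degree x = 1 := by
        obtain ⟨a, b, hab, ha, hb⟩ := hT.exists_ne_and_degree_eq_one
        by_cases har : a = r
        · exact ⟨b, har ▸ hab.symm, hb⟩
        · exact ⟨a, har, ha⟩
      obtain ⟨z, hz, hz'⟩ := (degree_eq_one_iff_existsUnique_adj).1 hdeg
      have hx : ∀ u, T.Adj x u ↔ u = z := fun u => ⟨hz' u, fun h => h ▸ hz⟩
      obtain ⟨t, h1, h2⟩ := ih (T.induce {x}ᶜ) ⟨r, hxr.symm⟩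
        (fun u : ({x}ᶜ : Set X) => if u = ⟨z, hz.ne'⟩ then graft (τ z) (τ x) else τ u)
        (by rw [Fintype.card_compl_set]; simp [hn])
        ⟨hT.1.induce_compl_singleton_of_degree_eq_one hdeg, hT.2.induce _⟩
      refine ⟨t, fun y => ?_, fun y => ?_⟩
      · rw [← h1, prod_homCount_leaf T hxr.symm hz.ne' hx]
      · rw [← h2, prod_homCount_leaf T hxr.symm hz.ne' hx]

theorem exists_homCount_eq_rootedHomCount {X Y Y' : Type*} [Finite X] [Fintype Y] [Fintype Y']
    (A : SimpleGraph Y) (A' : SimpleGraph Y') {T : SimpleGraph X} (hT : T.IsTree) (r : X) :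
    ∃ t : GraftTree, (∀ y, rootedHomCount T r A y = homCount A t y) ∧
      ∀ y, rootedHomCount T r A' y = homCount A' t y := by
  classical
  have := Fintype.ofFinite X
  have : ∀ y, Fintype {h : T →g A // h r = y} := fun y => Fintype.ofFinite _
  have : ∀ y, Fintype {h : T →g A' // h r = y} := fun y => Fintype.ofFinite _
  obtain ⟨t, h1, h2⟩ := exists_prod_homCount_eq A A' _ T r (fun _ => leaf) rfl hT
  refine ⟨t, fun y => ?_, fun y => ?_⟩
  · rw [← h1]
    simp [homCount, rootedHomCount]
  · rw [← h2]
    simp [homCount, rootedHomCount]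

end GraftTree

/-! ### Incidence homomorphisms as homomorphisms of incidence graphs. -/

namespace MultiHypergraph
open SimpleGraph GraftTree

variable {V E W F : Type*}

theorem incidenceGraph_adj_inl_inr {G : MultiHypergraph V E} {v : V} {e : E} :
    G.incidenceGraph.Adj (Sum.inl v) (Sum.inr e) ↔ v ∈ G.inc e := by
  simp [incidenceGraph]

theorem incidenceGraph_adj_inr_inl {G : MultiHypergraph V E} {v : V} {e : E} :
    G.incidenceGraph.Adj (Sum.inr e) (Sum.inl v) ↔ v ∈ G.inc e := by
  simp [incidenceGraph]

theorem incidenceGraph_not_adj_inl_inl {G : MultiHypergraph V E} {u v : V} :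
    ¬ G.incidenceGraph.Adj (Sum.inl u) (Sum.inl v) := by
  simp [incidenceGraph]

theorem incidenceGraph_not_adj_inr_inr {G : MultiHypergraph V E} {e f : E} :
    ¬ G.incidenceGraph.Adj (Sum.inr e) (Sum.inr f) := by
  simp [incidenceGraph]

theorem isLeft_ne_of_incidenceGraph_adj {G : MultiHypergraph V E} {x y : V ⊕ E}
    (h : G.incidenceGraph.Adj x y) : x.isLeft = !y.isLeft := by
  rcases x with x | x <;> rcases y with y | y <;> simp [incidenceGraph] at h ⊢

/-- The homomorphism of incidence graphs given by an incidence homomorphism. -/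
def IsIncidenceHom.toHom {B : MultiHypergraph W F} {G : MultiHypergraph V E}
    {h : (W → V) × (F → E)} (hh : B.IsIncidenceHom G h) : B.incidenceGraph →g G.incidenceGraph where
  toFun := Sum.map h.1 h.2
  map_rel' {a b} hab := by
    rcases a with a | a <;> rcases b with b | b
    · exact (incidenceGraph_not_adj_inl_inl hab).elim
    · exact incidenceGraph_adj_inl_inr.2 (hh _ _ (incidenceGraph_adj_inl_inr.1 hab))
    · exact incidenceGraph_adj_inr_inl.2 (hh _ _ (incidenceGraph_adj_inr_inl.1 hab))
    · exact (incidenceGraph_not_adj_inr_inr hab).elim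

/-- Each step of a walk switches sides in both bipartite graphs, so agreement at `w` propagates
along walks. -/
theorem IsConnected.isLeft_hom_apply {B : MultiHypergraph W F} (hB : B.IsConnected)
    {G : MultiHypergraph V E} (h : B.incidenceGraph →g G.incidenceGraph) {w : W} {v : V}
    (hw : h (Sum.inl w) = Sum.inl v) (x : W ⊕ F) : (h x).isLeft = x.isLeft := by
  have hw' : (h (Sum.inl w)).isLeft = (Sum.inl w : W ⊕ F).isLeft := by rw [hw]; rfl
  obtain ⟨p⟩ := hB.preconnected x (Sum.inl w)
  generalize (Sum.inl w : W ⊕ F) = y at hw' p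
  induction p with
  | nil => exact hw'
  | cons hadj p ih =>
    rw [isLeft_ne_of_incidenceGraph_adj hadj, ← ih hw',
      isLeft_ne_of_incidenceGraph_adj (h.map_rel hadj)]

theorem IsConnected.inHom_eq_sum {B : MultiHypergraph W F} (hB : B.IsConnected) (w : W)
    [Finite W] [Finite F] [Fintype V] [Finite E] (G : MultiHypergraph V E) :
    B.inHom G = ∑ v, rootedHomCount B.incidenceGraph (Sum.inl w) G.incidenceGraph (Sum.inl v) := by
  simp_rw [rootedHomCount]
  rw [← Nat.card_sigma]
  refine Nat.card_eq_of_bijective (fun h => ⟨h.1.1 w, h.2.toHom, rfl⟩) ⟨?_, ?_⟩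
  · rintro ⟨⟨hV, hE⟩, hh⟩ ⟨⟨kV, kE⟩, hk⟩ heq
    have h1 : hh.toHom = hk.toHom := by
      have := congrArg (fun p : (v : V) × {h : B.incidenceGraph →g G.incidenceGraph //
        h (Sum.inl w) = Sum.inl v} => p.2.1) heq
      exact this
    have h2 : ∀ x, Sum.map hV hE x = Sum.map kV kE x := fun x => DFunLike.congr_fun h1 x
    have h3 : hV = kV := funext fun x => Sum.inl_injective (h2 (Sum.inl x))
    have h4 : hE = kE := funext fun x => Sum.inr_injective (h2 (Sum.inr x))
    subst h3 h4
    rfl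
  · rintro ⟨v, h, hw⟩
    have hl : ∀ x, ∃ u, h (Sum.inl x) = Sum.inl u := fun x =>
      Sum.isLeft_iff.1 (hB.isLeft_hom_apply h hw (Sum.inl x))
    have hr : ∀ f, ∃ e, h (Sum.inr f) = Sum.inr e := fun f =>
      Sum.isRight_iff.1 (by simpa using hB.isLeft_hom_apply h hw (Sum.inr f))
    choose hV hV' using hl
    choose hE hE' using hr
    have hh : B.IsIncidenceHom G (hV, hE) := fun f x hx => by
      have := h.map_rel (incidenceGraph_adj_inl_inr.2 hx)
      rw [hV', hE'] at this
      exact incidenceGraph_adj_inl_inr.1 this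
    have h1 : hh.toHom = h := by
      ext x
      rcases x with x | x
      · exact (hV' x).symm
      · exact (hE' x).symm
    obtain rfl : hV w = v := Sum.inl_injective ((hV' w).symm.trans hw)
    refine ⟨⟨(hV, hE), hh⟩, ?_⟩
    subst h1
    rfl

/-- In a 2-coloring of the tree, the color class of `r` becomes the vertices and the other class the
edges; `ULift` reaches arbitrary universes. -/
theorem exists_iso_incidenceGraph.{u, v} {X : Type} [Finite X] {T : SimpleGraph X} (hT : T.IsTree)
    (r : X) : ∃ (W : Type u) (F : Type v) (_ : Finite W) (_ : Finite F) (B : MultiHypergraph W F)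
      (w : W) (e : B.incidenceGraph ≃g T), e (Sum.inl w) = r := by
  classical
  have := Fintype.ofFinite X
  obtain ⟨c⟩ := hT.colorable_two
  have hc : ∀ {a b : X}, T.Adj a b → (c a = c r ↔ c b ≠ c r) := fun {a b} hab => by
    have := c.valid hab
    omega
  let e : ULift.{u} {x // c x = c r} ⊕ ULift.{v} {x // c x ≠ c r} ≃ X :=
    (Equiv.sumCongr Equiv.ulift Equiv.ulift).trans (Equiv.sumCompl _)
  let B : MultiHypergraph (ULift.{u} {x // c x = c r}) (ULift.{v} {x // c x ≠ c r}) :=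
    { inc f := univ.filter fun w => T.Adj (e (Sum.inl w)) (e (Sum.inr f))
      inc_nonempty f := by
        -- A node of the other class differs from `r`, so connectedness gives it a neighbor and the
        -- edge is nonempty.
        have hne : r ≠ f.down.1 := fun h => f.down.2 (h ▸ rfl)
        have : Nontrivial X := ⟨r, _, hne⟩
        obtain ⟨y, hy⟩ := (not_forall_not.1 (hT.1.preconnected.not_isIsolated f.down.1))
        exact ⟨⟨y, (hc hy.symm).2 f.down.2⟩, by simpa [e] using hy.symm⟩ }
  refine ⟨_, _, inferInstance, inferInstance, B, ⟨r, rfl⟩, ⟨e, ?_⟩, rfl⟩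
  rintro (a | a) (b | b)
  · refine iff_of_false (fun h => (hc h).1 a.down.2 b.down.2) incidenceGraph_not_adj_inl_inl
  · rw [incidenceGraph_adj_inl_inr]
    simp [B]
  · rw [incidenceGraph_adj_inr_inl, T.adj_comm]
    simp [B]
  · refine iff_of_false (fun h => a.down.2 ((hc h).2 b.down.2)) incidenceGraph_not_adj_inr_inr

end MultiHypergraph

/-! ### Characters versus refinement colors. -/

namespace GraftTree
open SimpleGraph

open Classical in
-- Evaluating the character at `graft leaf t` gives the sum over the neighbors of their characters
-- at `t`.
theorem rel_neighbors_of_homCountHom_eq {Y Y' : Type*} [Fintype Y] [Fintype Y']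
    {A : SimpleGraph Y} {A' : SimpleGraph Y'} {y : Y} {y' : Y'}
    (h : homCountHom A y = homCountHom A' y') :
    Multiset.Rel (fun z z' => homCountHom A z = homCountHom A' z')
      (univ.filter (A.Adj y)).val (univ.filter (A'.Adj y')).val := by
  refine Multiset.rel_of_sum_map_eq fun t => ?_
  have := DFunLike.congr_fun h (graft leaf t)
  change homCount A (graft leaf t) y = homCount A' (graft leaf t) y' at this
  simp only [homCount, one_mul] at this
  exact this

end GraftTree

namespace MultiHypergraph
open SimpleGraph GraftTree

variable {V E V' E' : Type*} [Fintype E] [Fintype E']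

open Classical in
theorem rel_refColor_of_succ {G : MultiHypergraph V E} {H : MultiHypergraph V' E'} {n : ℕ} {v : V} {v' : V'}
    (h : G.refColor (n + 1) v = H.refColor (n + 1) v') :
    Multiset.Rel (fun e e' =>
        (G.inc e).val.map (G.refColor n) = (H.inc e').val.map (H.refColor n))
      (univ.filter fun e => v ∈ G.inc e).val (univ.filter fun e => v' ∈ H.inc e).val :=
  Multiset.rel_of_map_eq_map h

theorem refColor_eq_of_le {G : MultiHypergraph V E} {H : MultiHypergraph V' E'} {m n : ℕ}
    (hmn : m ≤ n) : ∀ {v : V} {v' : V'}, G.refColor n v = H.refColor n v' →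
      G.refColor m v = H.refColor m v' := by
  classical
  induction m generalizing n with
  | zero => exact fun _ => rfl
  | succ m ih =>
    obtain ⟨n, rfl⟩ : ∃ k, n = k + 1 := ⟨n - 1, by omega⟩
    intro v v' h
    exact (rel_refColor_of_succ h).map_eq_map fun e e' h2 =>
      (Multiset.rel_of_map_eq_map h2).map_eq_map fun u u' => ih (Nat.le_of_succ_le_succ hmn)

theorem edgeColor_eq_of_le {G : MultiHypergraph V E} {H : MultiHypergraph V' E'} {m n : ℕ}
    (hmn : m ≤ n) {e : E} {e' : E'}
    (h : (G.inc e).val.map (G.refColor n) = (H.inc e').val.map (H.refColor n)) :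
    (G.inc e).val.map (G.refColor m) = (H.inc e').val.map (H.refColor m) :=
  (Multiset.rel_of_map_eq_map h).map_eq_map fun _ _ => refColor_eq_of_le hmn

variable [Fintype V] [Fintype V']

open Classical in
theorem neighbors_inl (G : MultiHypergraph V E) (v : V) :
    (univ.filter (G.incidenceGraph.Adj (Sum.inl v))).val =
      (univ.filter fun e => v ∈ G.inc e).val.map Sum.inr := by
  have : univ.filter (G.incidenceGraph.Adj (Sum.inl v)) =
      (univ.filter fun e => v ∈ G.inc e).map Function.Embedding.inr := by
    ext x
    rcases x with x | x <;> simp [incidenceGraph]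
  rw [this]
  rfl

open Classical in
theorem neighbors_inr (G : MultiHypergraph V E) (e : E) :
    (univ.filter (G.incidenceGraph.Adj (Sum.inr e))).val = (G.inc e).val.map Sum.inl := by
  have : univ.filter (G.incidenceGraph.Adj (Sum.inr e)) =
      (G.inc e).map Function.Embedding.inl := by
    ext x
    rcases x with x | x <;> simp [incidenceGraph]
  rw [this]
  rfl

theorem refColor_eq_of_homCountHom_eq (G : MultiHypergraph V E) (H : MultiHypergraph V' E')
    (n : ℕ) : ∀ (v : V) (v' : V'), homCountHom G.incidenceGraph (Sum.inl v) =
      homCountHom H.incidenceGraph (Sum.inl v') → G.refColor n v = H.refColor n v' := by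
  classical
  induction n with
  | zero => exact fun _ _ _ => rfl
  | succ n ih =>
    intro v v' h
    -- One refinement round is two steps in the incidence graph: to the edges, then back to
    -- vertices.
    have h1 := rel_neighbors_of_homCountHom_eq h
    rw [neighbors_inl, neighbors_inl, Multiset.rel_map] at h1
    refine h1.map_eq_map fun e e' h2 => ?_
    have h3 := rel_neighbors_of_homCountHom_eq h2
    rw [neighbors_inr, neighbors_inr, Multiset.rel_map] at h3
    exact h3.map_eq_map ih

theorem exists_homCount_eq_of_refColor_eq (G : MultiHypergraph V E) (H : MultiHypergraph V' E')
    (t : GraftTree) : ∃ n,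
      (∀ v v', G.refColor n v = H.refColor n v' →
        homCount G.incidenceGraph t (Sum.inl v) = homCount H.incidenceGraph t (Sum.inl v')) ∧
      ∀ e e', (G.inc e).val.map (G.refColor n) = (H.inc e').val.map (H.refColor n) →
        homCount G.incidenceGraph t (Sum.inr e) = homCount H.incidenceGraph t (Sum.inr e') := by
  classical
  induction t with
  | leaf => exact ⟨0, fun _ _ _ => rfl, fun _ _ _ => rfl⟩
  | graft s t ihs iht =>
    obtain ⟨k, hk, hk'⟩ := ihs
    obtain ⟨l, hl, hl'⟩ := iht
    -- The vertex color of round `l + 1` is what lists the edge colors of round `l`; for edges,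
    -- round `l` would suffice.
    refine ⟨max k (l + 1), fun v v' h => ?_, fun e e' h => ?_⟩
    · simp only [homCount]
      rw [hk v v' (refColor_eq_of_le (le_max_left _ _) h)]
      congr 1
      simp only [Finset.sum]
      rw [neighbors_inl, neighbors_inl, Multiset.map_map, Multiset.map_map]
      exact congrArg _ ((rel_refColor_of_succ (refColor_eq_of_le (le_max_right _ _) h)).map_eq_map
        hl')
    · simp only [homCount]
      rw [hk' e e' (edgeColor_eq_of_le (le_max_left _ _) h)]
      congr 1
      simp only [Finset.sum]
      rw [neighbors_inr, neighbors_inr, Multiset.map_map, Multiset.map_map]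
      exact congrArg _ ((Multiset.rel_of_map_eq_map (edgeColor_eq_of_le
        ((Nat.le_succ l).trans (le_max_right _ _)) h)).map_eq_map hl)

end MultiHypergraph

/-! ### The equivalence. -/

theorem mainTheorem5 {V E V' E' : Type*} [Fintype V] [Fintype E] [Fintype V'] [Fintype E']
    (G : MultiHypergraph V E) (H : MultiHypergraph V' E') :
    (∀ (W : Type*) (F : Type*) [Finite W] [Finite F] (B : MultiHypergraph W F),
      B.IsConnected → B.IsBergeAcyclic → B.inHom G = B.inHom H) ↔
    ¬ G.ColorRefinementDistinguishes H := by
  constructor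
  · rintro h ⟨n, hn⟩
    refine hn (Multiset.Rel.map_eq_map (Multiset.rel_of_sum_map_eq fun t => ?_)
      (MultiHypergraph.refColor_eq_of_homCountHom_eq G H n))
    obtain ⟨X, _, T, r, hT, h1, h2⟩ := t.exists_isTree_rootedHomCount_eq G.incidenceGraph
      H.incidenceGraph
    obtain ⟨W, F, _, _, B, w, e, rfl⟩ := MultiHypergraph.exists_iso_incidenceGraph hT r
    have hB : B.IsConnected := e.connected_iff.2 hT.1
    have := h W F B hB (e.isAcyclic_iff.2 hT.2)
    rw [hB.inHom_eq_sum w, hB.inHom_eq_sum w] at this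
    simp_rw [e.rootedHomCount_eq, h1, h2] at this
    exact this
  · intro h W F _ _ B hB hB'
    -- The root must lie on the vertex side; an edge supplies one because edges are nonempty.
    obtain ⟨w⟩ : Nonempty W := by
      obtain ⟨w | f⟩ := hB.nonempty
      · exact ⟨w⟩
      · exact ⟨(B.inc_nonempty f).choose⟩
    obtain ⟨t, h1, h2⟩ := GraftTree.exists_homCount_eq_rootedHomCount G.incidenceGraph
      H.incidenceGraph ⟨hB, hB'⟩ (Sum.inl w)
    obtain ⟨n, hn, -⟩ := MultiHypergraph.exists_homCount_eq_of_refColor_eq G H t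
    rw [hB.inHom_eq_sum w, hB.inHom_eq_sum w]
    simp_rw [h1, h2]
    by_contra hne
    exact h ⟨n, fun heq => hne (congrArg Multiset.sum
      ((Multiset.rel_of_map_eq_map heq).map_eq_map hn))⟩
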